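/- Let $F$ be a complete non-archimedean (ultrametric) valued field. The Berkovich affine line $\mathbb{A}^{1,\mathrm{an}}_F$ is the set of multiplicative seminorms $x : P\mapsto |P(x)|$ on $F[T]$ that extend the absolute value of $F$, with the weakest topology making all maps $x\mapsto |P(x)|$ continuous; $\mathscr{H}(x)$ denotes the completion of the fraction field of $F[T]/\{P : |P(x)|=0\}$ for the absolute value induced by $x$, and $T(x)\in\mathscr{H}(x)$ the image of $T$. For an ultrametric $F$-Banach algebra $E$ with unit and $f\in E$, the spectrum $\Sigma_{f,F}(E)$ is the set of all $x\in\mathbb{A}^{1,\mathrm{an}}_F$ such that $f\otimes 1-1\otimes T(x)$ is not invertible in the completed tensor product $E\,\widehat{\otimes}_F\,\mathscr{H}(x)$ (completion for the seminorm $\|z\|=\inf\{\max_i\|a_i\|\,\|b_i\| : z=\sum_i a_i\otimes b_i\}$). Let $\mathcal{K}(\mathbb{A}^{1,\mathrm{an}}_F)$ be the set of nonempty compact subsets of $\mathbb{A}^{1,\mathrm{an}}_F$ with the exponential topology, generated by the sets $\{\Sigma : \Sigma\subset U,\ \Sigma\cap U_i\neq\varnothing\ \text{for all } i\in I\}$,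 where $U$ is open and $\{U_i\}_{i\in I}$ is a finite open cover of $U$. **Theorem.** Let $E$ be a non-zero commutative ultrametric $F$-Banach algebra with unit. Then $\Sigma_{f,F}(E)$ is a nonempty compact subset of $\mathbb{A}^{1,\mathrm{an}}_F$ for every $f\in E$, and the map $$\Sigma_{\cdot,F}: E\to\mathcal{K}(\mathbb{A}^{1,\mathrm{an}}_F),\qquad f\mapsto\Sigma_{f,F}(E),$$ is continuous. -/

import Mathlib

open scoped TensorProduct Polynomial

namespace BerkovichSpectrum

noncomputable section

/-! ### The Berkovich affine line -/

/-- A point of the Berkovich affine line over `F`: a multiplicative seminorm on `F[T]` whose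
restriction to `F` is the given absolute value. -/
structure AffineLine (F : Type*) [NormedField F] where
  /-- The seminorm `P ↦ |P(x)|` attached to the point `x`. -/
  seminorm : MulRingSeminorm F[X]
  seminorm_C : ∀ a : F, seminorm (Polynomial.C a) = ‖a‖

namespace AffineLine

/-- The weakest topology for which `x ↦ |P(x)|` is continuous for every polynomial `P`. -/
instance (F : Type*) [NormedField F] : TopologicalSpace (AffineLine F) :=
  TopologicalSpace.induced (fun (x : AffineLine F) (P : F[X]) => x.seminorm P) inferInstance

variable {F : Type*} [NormedField F] (x : AffineLine F)

/-- The prime ideal of all polynomials `P` with `|P(x)| = 0`. -/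
def ker : Ideal F[X] where
  carrier := {P | x.seminorm P = 0}
  zero_mem' := map_zero x.seminorm
  add_mem' {P Q} hP hQ := by
    have h := map_add_le_add x.seminorm P Q
    rw [Set.mem_ofPred_eq] at hP hQ ⊢
    rw [hP, hQ, add_zero] at h
    exact le_antisymm h (apply_nonneg _ _)
  smul_mem' P Q hQ := by
    rw [Set.mem_ofPred_eq] at hQ ⊢
    rw [smul_eq_mul, map_mul, hQ, mul_zero]

theorem mem_ker {P : F[X]} : P ∈ x.ker ↔ x.seminorm P = 0 := Iff.rfl

instance ker_isPrime : x.ker.IsPrime where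
  ne_top' := by
    rw [Ne, Ideal.eq_top_iff_one, mem_ker, map_one]
    exact one_ne_zero
  mem_or_mem' {P Q} h := by
    rwa [mem_ker, map_mul, mul_eq_zero] at h

/-- The absolute value that `x` induces on the domain `F[T] / ker x`. -/
def quotientAbs : AbsoluteValue (F[X] ⧸ x.ker) ℝ where
  toFun := Quotient.lift (fun P : F[X] => x.seminorm P) fun P Q h => by
    have h0 : x.seminorm (P - Q) = 0 := (Submodule.quotientRel_def _).1 h
    have h1 := abs_sub_map_le_sub x.seminorm P Q
    rw [h0] at h1
    exact sub_eq_zero.1 (abs_nonpos_iff.1 h1)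
  map_mul' := by
    intro a b
    obtain ⟨P, rfl⟩ := Ideal.Quotient.mk_surjective a
    obtain ⟨Q, rfl⟩ := Ideal.Quotient.mk_surjective b
    exact map_mul x.seminorm P Q
  nonneg' := by
    intro a
    obtain ⟨P, rfl⟩ := Ideal.Quotient.mk_surjective a
    exact apply_nonneg x.seminorm P
  eq_zero' := by
    intro a
    obtain ⟨P, rfl⟩ := Ideal.Quotient.mk_surjective a
    exact Iff.symm Ideal.Quotient.eq_zero_iff_mem
  add_le' := by
    intro a b
    obtain ⟨P, rfl⟩ := Ideal.Quotient.mk_surjective a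
    obtain ⟨Q, rfl⟩ := Ideal.Quotient.mk_surjective b
    exact map_add_le_add x.seminorm P Q

theorem quotientAbs_mk (P : F[X]) : x.quotientAbs (Ideal.Quotient.mk x.ker P) = x.seminorm P :=
  rfl

end AffineLine

/-- The function `a / b ↦ |a| / |b|` on the field of fractions of a domain with an absolute value
(evaluated at one chosen way of writing an element as a fraction). -/
def fractionAbsFun {R : Type*} [CommRing R] (v : AbsoluteValue R ℝ) (z : FractionRing R) : ℝ :=
  v (IsLocalization.sec (nonZeroDivisors R) z).1 / v (IsLocalization.sec (nonZeroDivisors R) z).2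

theorem fractionAbsFun_div {R : Type*} [CommRing R] [IsDomain R] (v : AbsoluteValue R ℝ)
    (a : R) {b : R} (hb : b ≠ 0) :
    fractionAbsFun v (algebraMap R (FractionRing R) a / algebraMap R (FractionRing R) b) =
      v a / v b := by
  have inj := IsFractionRing.injective R (FractionRing R)
  have hs := IsLocalization.sec_spec (nonZeroDivisors R)
    (algebraMap R (FractionRing R) a / algebraMap R (FractionRing R) b)
  have hd := nonZeroDivisors.ne_zero (IsLocalization.sec (nonZeroDivisors R)
    (algebraMap R (FractionRing R) a / algebraMap R (FractionRing R) b)).2.2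
  have hb' : algebraMap R (FractionRing R) b ≠ 0 := fun h => hb (inj (by rw [h, map_zero]))
  rw [div_mul_eq_mul_div, div_eq_iff hb', ← map_mul, ← map_mul] at hs
  have hs' := congrArg v (inj hs)
  rw [map_mul, map_mul] at hs'
  exact (div_eq_div_iff (v.ne_zero hd) (v.ne_zero hb)).2 (by linarith)

/-- The unique extension of an absolute value from a domain to its field of fractions. -/
def fractionAbs {R : Type*} [CommRing R] [IsDomain R] (v : AbsoluteValue R ℝ) :
    AbsoluteValue (FractionRing R) ℝ where
  toFun := fractionAbsFun v
  map_mul' := by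
    intro z w
    obtain ⟨a, b, hb, rfl⟩ := IsFractionRing.div_surjective (A := R) z
    obtain ⟨c, d, hd, rfl⟩ := IsFractionRing.div_surjective (A := R) w
    have hb := nonZeroDivisors.ne_zero hb
    have hd := nonZeroDivisors.ne_zero hd
    rw [div_mul_div_comm, ← map_mul, ← map_mul, fractionAbsFun_div v _ (mul_ne_zero hb hd),
      fractionAbsFun_div v _ hb, fractionAbsFun_div v _ hd, map_mul, map_mul, div_mul_div_comm]
  nonneg' := fun z => div_nonneg (v.nonneg _) (v.nonneg _)
  eq_zero' := by
    intro z
    obtain ⟨a, b, hb, rfl⟩ := IsFractionRing.div_surjective (A := R) z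
    have hb := nonZeroDivisors.ne_zero hb
    rw [fractionAbsFun_div v _ hb]
    simp [hb]
  add_le' := by
    intro z w
    obtain ⟨a, b, hb, rfl⟩ := IsFractionRing.div_surjective (A := R) z
    obtain ⟨c, d, hd, rfl⟩ := IsFractionRing.div_surjective (A := R) w
    have hb := nonZeroDivisors.ne_zero hb
    have hd := nonZeroDivisors.ne_zero hd
    rw [div_add_div _ _ (by simpa using hb) (by simpa using hd), ← map_mul, ← map_mul,
      ← map_mul, ← map_add, fractionAbsFun_div v _ (mul_ne_zero hb hd),
      fractionAbsFun_div v _ hb, fractionAbsFun_div v _ hd,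
      div_add_div _ _ (v.ne_zero hb) (v.ne_zero hd), ← map_mul, ← map_mul, ← map_mul]
    have h := v.add_le (a * d) (b * c)
    exact div_le_div_of_nonneg_right h (v.nonneg _)

theorem fractionAbs_algebraMap {R : Type*} [CommRing R] [IsDomain R] (v : AbsoluteValue R ℝ)
    (a : R) : fractionAbs v (algebraMap R (FractionRing R) a) = v a := by
  have h := fractionAbsFun_div v a (one_ne_zero : (1 : R) ≠ 0)
  rw [map_one, map_one, div_one, div_one] at h
  exact h

namespace AffineLine

variable {F : Type*} [NormedField F] (x : AffineLine F)

/-- The residue field of the point `x`: the field of fractions of `F[T] / ker x`. -/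
def ResidueField : Type _ := FractionRing (F[X] ⧸ x.ker)

instance : Field x.ResidueField := inferInstanceAs (Field (FractionRing (F[X] ⧸ x.ker)))

/-- The evaluation `P ↦ P(x)` of polynomials in the residue field of `x`. -/
def toResidueField : F[X] →+* x.ResidueField :=
  (algebraMap (F[X] ⧸ x.ker) (FractionRing (F[X] ⧸ x.ker))).comp (Ideal.Quotient.mk x.ker)

/-- The absolute value that `x` induces on its residue field. -/
def residueAbs : AbsoluteValue x.ResidueField ℝ := fractionAbs x.quotientAbs

instance : NormedField x.ResidueField :=
  x.residueAbs.toNormedField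

theorem norm_toResidueField (P : F[X]) : ‖x.toResidueField P‖ = x.seminorm P :=
  fractionAbs_algebraMap x.quotientAbs (Ideal.Quotient.mk x.ker P)

instance : NormedAlgebra F x.ResidueField where
  __ := (x.toResidueField.comp Polynomial.C).toAlgebra
  norm_smul_le a z := by
    change ‖x.toResidueField (Polynomial.C a) * z‖ ≤ ‖a‖ * ‖z‖
    rw [norm_mul, norm_toResidueField, x.seminorm_C]

/-- The completed residue field `ℋ(x)`. -/
abbrev CompletedResidueField : Type _ := UniformSpace.Completion x.ResidueField

/-- The value `T(x) ∈ ℋ(x)` of the coordinate function at `x`. -/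
def coord : x.CompletedResidueField := (x.toResidueField Polynomial.X : x.ResidueField)

end AffineLine

/-! ### The completed tensor product -/

/-- The algebra `A ⊗ B` over `F`, to be endowed with the ultrametric tensor seminorm. -/
def UltraTensor (F A B : Type*) [NormedField F] [NormedRing A] [NormedAlgebra F A] [NormedRing B]
    [NormedAlgebra F B] : Type _ := A ⊗[F] B

namespace UltraTensor

variable {F A B : Type*} [NormedField F] [NormedRing A] [NormedAlgebra F A] [NormedRing B]
  [NormedAlgebra F B]

instance : Ring (UltraTensor F A B) := inferInstanceAs (Ring (A ⊗[F] B))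

/-- The elementary tensor `a ⊗ b`. -/
def tmul (F : Type*) {A B : Type*} [NormedField F] [NormedRing A] [NormedAlgebra F A]
    [NormedRing B] [NormedAlgebra F B] (a : A) (b : B) : UltraTensor F A B := a ⊗ₜ[F] b

theorem tmul_mul_tmul (a a' : A) (b b' : B) :
    tmul F a b * tmul F a' b' = tmul F (a * a') (b * b') :=
  Algebra.TensorProduct.tmul_mul_tmul a a' b b'

/-- `HasRep z r` holds if `z` can be written as a finite sum `∑ aᵢ ⊗ bᵢ` such that
`max ‖aᵢ‖ * ‖bᵢ‖ ≤ r` (the maximum of an empty family being `0`). -/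
def HasRep (z : UltraTensor F A B) (r : ℝ) : Prop :=
  0 ≤ r ∧ ∃ l : List (A × B), z = (l.map fun p => tmul F p.1 p.2).sum ∧ ∀ p ∈ l, ‖p.1‖ * ‖p.2‖ ≤ r

theorem hasRep_zero : HasRep (0 : UltraTensor F A B) 0 := ⟨le_rfl, [], by simp⟩

theorem HasRep.add {z w : UltraTensor F A B} {r s : ℝ} (hz : HasRep z r) (hw : HasRep w s) :
    HasRep (z + w) (max r s) := by
  obtain ⟨hr, l, rfl, hl⟩ := hz
  obtain ⟨hs, m, rfl, hm⟩ := hw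
  refine ⟨le_max_of_le_left hr, l ++ m, by simp, fun p hp => ?_⟩
  rcases List.mem_append.1 hp with h | h
  · exact (hl p h).trans (le_max_left _ _)
  · exact (hm p h).trans (le_max_right _ _)

theorem HasRep.neg {z : UltraTensor F A B} {r : ℝ} (hz : HasRep z r) : HasRep (-z) r := by
  obtain ⟨hr, l, rfl, hl⟩ := hz
  refine ⟨hr, l.map fun p => (-p.1, p.2), ?_, ?_⟩
  · clear hl
    induction l with
    | nil => simp
    | cons p l ih =>
      rw [List.map_cons, List.sum_cons, neg_add, ih, List.map_cons, List.map_cons, List.sum_cons]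
      congr 1
  · intro p hp
    obtain ⟨q, hq, rfl⟩ := List.mem_map.1 hp
    simpa using hl q hq

theorem HasRep.mul {z w : UltraTensor F A B} {r s : ℝ} (hz : HasRep z r) (hw : HasRep w s) :
    HasRep (z * w) (r * s) := by
  obtain ⟨hr, l, rfl, hl⟩ := hz
  obtain ⟨hs, m, rfl, hm⟩ := hw
  refine ⟨mul_nonneg hr hs, (l ×ˢ m).map fun q => (q.1.1 * q.2.1, q.1.2 * q.2.2), ?_, ?_⟩
  · clear hl hm
    induction l with
    | nil => simp
    | cons p l ih =>
      rw [List.map_cons, List.sum_cons, add_mul, ih, List.product_cons, List.map_append,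
        List.map_append, List.sum_append]
      congr 1
      rw [← List.sum_map_mul_left, List.map_map, List.map_map]
      congr 1
      exact List.map_congr_left fun q _ => tmul_mul_tmul _ _ _ _
  · intro p hp
    obtain ⟨q, hq, rfl⟩ := List.mem_map.1 hp
    obtain ⟨h1, h2⟩ := List.mem_product.1 hq
    calc ‖q.1.1 * q.2.1‖ * ‖q.1.2 * q.2.2‖
        ≤ (‖q.1.1‖ * ‖q.2.1‖) * (‖q.1.2‖ * ‖q.2.2‖) := by
          gcongr <;> exact norm_mul_le _ _
      _ = (‖q.1.1‖ * ‖q.1.2‖) * (‖q.2.1‖ * ‖q.2.2‖) := by ring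
      _ ≤ r * s := mul_le_mul (hl _ h1) (hm _ h2) (by positivity) hr

theorem hasRep_tmul (a : A) (b : B) : HasRep (tmul F a b) (‖a‖ * ‖b‖) :=
  ⟨by positivity, [(a, b)], by simp⟩

theorem exists_hasRep (z : UltraTensor F A B) : ∃ r, HasRep z r := by
  refine TensorProduct.induction_on (motive := fun z => ∃ r, HasRep (z : UltraTensor F A B) r) z
    ⟨0, hasRep_zero⟩ (fun a b => ⟨_, hasRep_tmul a b⟩) ?_
  rintro z w ⟨r, hr⟩ ⟨s, hs⟩
  exact ⟨_, hr.add hs⟩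

/-- The ultrametric tensor seminorm:
`‖z‖` is the infimum of `max ‖aᵢ‖ * ‖bᵢ‖` over all finite expressions `z = ∑ aᵢ ⊗ bᵢ`. -/
def tensorNorm (z : UltraTensor F A B) : ℝ := sInf {r | HasRep z r}

theorem HasRep.tensorNorm_le {z : UltraTensor F A B} {r : ℝ} (h : HasRep z r) :
    tensorNorm z ≤ r :=
  csInf_le ⟨0, fun _ hs => hs.1⟩ h

theorem tensorNorm_nonneg (z : UltraTensor F A B) : 0 ≤ tensorNorm z :=
  le_csInf (exists_hasRep z) fun _ hs => hs.1

theorem exists_hasRep_lt {z : UltraTensor F A B} {r : ℝ} (h : tensorNorm z < r) :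
    ∃ s < r, HasRep z s := by
  obtain ⟨s, hs, hsr⟩ := exists_lt_of_csInf_lt (exists_hasRep z) h
  exact ⟨s, hsr, hs⟩

/-- The ultrametric tensor seminorm is a submultiplicative seminorm. -/
def tensorSeminorm : RingSeminorm (UltraTensor F A B) where
  toFun := tensorNorm
  map_zero' := le_antisymm hasRep_zero.tensorNorm_le (tensorNorm_nonneg _)
  add_le' z w := by
    refine le_of_forall_pos_lt_add fun ε hε => ?_
    obtain ⟨r, hr, hzr⟩ := exists_hasRep_lt (lt_add_of_pos_right (tensorNorm z) (half_pos hε))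
    obtain ⟨s, hs, hws⟩ := exists_hasRep_lt (lt_add_of_pos_right (tensorNorm w) (half_pos hε))
    have h1 := (hzr.add hws).tensorNorm_le
    have h2 : max r s ≤ r + s := max_le_add_of_nonneg hzr.1 hws.1
    linarith
  neg' z := by
    have key : ∀ w : UltraTensor F A B, tensorNorm (-w) ≤ tensorNorm w := fun w =>
      le_csInf (exists_hasRep w) fun _ hs => HasRep.tensorNorm_le (HasRep.neg hs)
    refine le_antisymm (key z) ?_
    have h := key (-z)
    rwa [neg_neg] at h
  mul_le' z w := by
    have h : ∀ r s : ℝ, tensorNorm z < r → tensorNorm w < s → tensorNorm (z * w) ≤ r * s := by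
      intro r s hr hs
      obtain ⟨r', hr', hz⟩ := exists_hasRep_lt hr
      obtain ⟨s', hs', hw⟩ := exists_hasRep_lt hs
      exact (hz.mul hw).tensorNorm_le.trans
        (mul_le_mul hr'.le hs'.le hw.1 ((tensorNorm_nonneg z).trans hr.le))
    exact le_mul_of_forall_lt₀ fun a ha b hb => h a b ha hb

instance : SeminormedRing (UltraTensor F A B) :=
  (tensorSeminorm (F := F) (A := A) (B := B)).toSeminormedRing

end UltraTensor

/-- The completed tensor product of `A` and `B` over `F`. -/
abbrev CompletedTensor (F A B : Type*) [NormedField F] [NormedRing A] [NormedAlgebra F A]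
    [NormedRing B] [NormedAlgebra F B] : Type _ :=
  UniformSpace.Completion (UltraTensor F A B)

/-- The elementary tensor `a ⊗ b` in the completed tensor product. -/
def CompletedTensor.tmul (F : Type*) {A B : Type*} [NormedField F] [NormedRing A]
    [NormedAlgebra F A] [NormedRing B] [NormedAlgebra F B] (a : A) (b : B) :
    CompletedTensor F A B :=
  (UltraTensor.tmul F a b : UltraTensor F A B)

/-! ### The spectrum -/

/-- The Berkovich spectrum `Σ_{f,F}(E)`: the set of all points `x` of the affine line such that
`f ⊗ 1 - 1 ⊗ T(x)` is not invertible in the completed tensor product of `E` and `ℋ(x)`. -/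
def berkovichSpectrum (F : Type*) {E : Type*} [NormedField F] [NormedRing E] [NormedAlgebra F E]
    (f : E) : Set (AffineLine F) :=
  {x | ¬ IsUnit (CompletedTensor.tmul F f (1 : x.CompletedResidueField) -
    CompletedTensor.tmul F (1 : E) x.coord)}

end

end BerkovichSpectrum

namespace BerkovichSpectrum

noncomputable section

/-! ### Multiplicative seminorms below a given seminorm -/

/-! Let M(E) be the space of multiplicative seminorms on E bounded by the norm (`GelfandSpectrum`).
Each y in M(E) and f in E give the point P ↦ |P(f)(y)| of the affine line, and the spectrum of f is
exactly the image of M(E) under this map (`berkovichSpectrum_eq_range`). M(E) is compact by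
Tychonoff and nonempty, and the point depends continuously on (f, y) jointly. The images of one
fixed compact space under a jointly continuous family vary continuously in the Vietoris topology.

For the equality, put b = f ⊗ 1 - 1 ⊗ T(x). If b is not invertible in the completion, the ideal (b)
stays at distance at least 1 from 1, so a multiplicative seminorm below the tensor seminorm kills b;
its restriction to E is the required y. Conversely, y maps E to a complete valued field that also
receives ℋ(x), and b becomes 0 there.

Both nonemptiness and the first inclusion rest on `exists_mulRingSeminorm_le`: smooth the seminorm
to a power-multiplicative one, take a minimal one below it by Zorn, and observe that minimality
forces multiplicativity. -/

/-- If the powers of `s` are bounded by the powers of `r` up to a constant, then `s ≤ r`. -/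
theorem le_of_pow_le_const_mul_pow {s r C : ℝ} (hr : 0 ≤ r) (h : ∀ n : ℕ, s ^ n ≤ C * r ^ n) :
    s ≤ r := by
  by_contra! hlt
  rcases hr.eq_or_lt with rfl | hr
  · have := h 1
    simp only [pow_one, mul_zero] at this
    exact this.not_gt hlt
  · obtain ⟨n, hn⟩ := pow_unbounded_of_one_lt C ((one_lt_div hr).2 hlt)
    rw [div_pow, lt_div_iff₀ (pow_pos hr n)] at hn
    exact (h n).not_gt hn

/-- A nonzero non-archimedean ring seminorm dominates a power-multiplicative one. -/
theorem exists_isPowMul_le {R : Type*} [CommRing R] (μ : RingSeminorm R)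
    (hna : IsNonarchimedean μ) (h1 : μ 1 ≠ 0) :
    ∃ p : RingSeminorm R, IsPowMul p ∧ p 1 = 1 ∧ ∀ a, p a ≤ μ a := by
  have hmul : ∀ x y, μ (x * y) ≤ 1 * μ x * μ y := fun x y => by
    rw [one_mul]
    exact map_mul_le_mul μ x y
  have hnn : 0 ≤ (μ : R → ℝ) := fun a => apply_nonneg μ a
  have hne : (μ : R → ℝ) ≠ 0 := fun h => h1 (congrFun h 1)
  -- ν(x) is the supremum of μ(xy)/μ(y). It lies below μ and has ν(1) = 1, the normalization that
  -- smoothing requires.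
  let ν := seminormFromBounded (map_zero μ) hnn hmul (map_add_le_add μ) (map_neg_eq_map μ)
  have hν1 : ν 1 = 1 := seminormFromBounded_one hne hnn hmul
  have hνna : IsNonarchimedean ν := seminormFromBounded_isNonarchimedean hnn hmul hna
  have hνμ : ∀ a, ν a ≤ μ a := fun a => by
    have h := seminormFromBounded_le hnn hmul a
    rwa [one_mul] at h
  refine ⟨smoothingSeminorm ν hν1.le hνna, isPowMul_smoothingFun ν hν1.le, ?_,
    fun a => (smoothingFun_le_self ν a).trans (hνμ a)⟩
  change (⨅ n : ℕ+, ν (1 ^ (n : ℕ)) ^ (1 / (n : ℝ))) = 1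
  simp only [one_pow, hν1, Real.one_rpow, ciInf_const]

/-- The infimum of a chain of ring seminorms. -/
def chainInf {R : Type*} [CommRing R] (c : Set (RingSeminorm R))
    (hc : IsChain (fun p q : RingSeminorm R => ∀ a, p a ≤ q a) c) (hne : c.Nonempty) :
    RingSeminorm R :=
  have : Nonempty c := hne.to_subtype
  have hb : ∀ a, BddBelow (Set.range fun p : c => p.1 a) := fun a =>
    ⟨0, by rintro _ ⟨p, rfl⟩; exact apply_nonneg p.1 a⟩
  -- Sums and products of two infima involve two members of the chain; a common lower member handles
  -- both at once.
  have hmin : ∀ p q : c, ∃ r : c, (∀ a, r.1 a ≤ p.1 a) ∧ ∀ a, r.1 a ≤ q.1 a := fun p q => by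
    by_cases h : p.1 = q.1
    · exact ⟨p, fun _ => le_rfl, fun a => by rw [h]⟩
    · rcases hc p.2 q.2 h with h | h
      · exact ⟨p, fun _ => le_rfl, h⟩
      · exact ⟨q, h, fun _ => le_rfl⟩
  { toFun := fun a => ⨅ p : c, p.1 a
    map_zero' := by simp
    neg' := fun a => by simp
    add_le' := fun a b => by
      refine le_ciInf_add_ciInf fun p q => ?_
      obtain ⟨r, hp, hq⟩ := hmin p q
      exact (ciInf_le (hb _) r).trans
        ((map_add_le_add r.1 a b).trans (add_le_add (hp a) (hq b)))
    mul_le' := fun a b => by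
      refine le_mul_of_forall_lt₀ fun s hs t ht => ?_
      obtain ⟨p, hp⟩ := exists_lt_of_ciInf_lt hs
      obtain ⟨q, hq⟩ := exists_lt_of_ciInf_lt ht
      obtain ⟨r, hrp, hrq⟩ := hmin p q
      refine (ciInf_le (hb _) r).trans ((map_mul_le_mul r.1 a b).trans ?_)
      exact mul_le_mul ((hrp a).trans hp.le) ((hrq b).trans hq.le) (apply_nonneg _ _)
        ((apply_nonneg p.1 a).trans hp.le) }

theorem chainInf_apply {R : Type*} [CommRing R] (c : Set (RingSeminorm R))
    (hc : IsChain (fun p q : RingSeminorm R => ∀ a, p a ≤ q a) c) (hne : c.Nonempty) (a : R) :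
    chainInf c hc hne a = ⨅ p : c, p.1 a := rfl

theorem chainInf_le {R : Type*} [CommRing R] {c : Set (RingSeminorm R)}
    (hc : IsChain (fun p q : RingSeminorm R => ∀ a, p a ≤ q a) c) (hne : c.Nonempty)
    {p : RingSeminorm R} (hp : p ∈ c) (a : R) : chainInf c hc hne a ≤ p a :=
  ciInf_le (f := fun q : c => q.1 a)
    ⟨0, by rintro _ ⟨p, rfl⟩; exact apply_nonneg p.1 a⟩ ⟨p, hp⟩

/-- Among the power-multiplicative ring seminorms below a given one there is a minimal one. -/
theorem exists_minimal_isPowMul {R : Type*} [CommRing R] (μ : RingSeminorm R)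
    (hpm : IsPowMul μ) (h1 : μ 1 = 1) :
    ∃ p : RingSeminorm R, IsPowMul p ∧ p 1 = 1 ∧ (∀ a, p a ≤ μ a) ∧
      ∀ q : RingSeminorm R, IsPowMul q → q 1 = 1 → (∀ a, q a ≤ p a) → ∀ a, p a ≤ q a := by
  let S := {p : RingSeminorm R // IsPowMul p ∧ p 1 = 1 ∧ ∀ a, p a ≤ μ a}
  -- The order is reversed, so that a maximal element for Zorn is a minimal seminorm.
  have hchain : ∀ c : Set S, IsChain (fun p q : S => ∀ a, q.1 a ≤ p.1 a) c →
      ∃ ub : S, ∀ p ∈ c, ∀ a, ub.1 a ≤ p.1 a := by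
    intro c hc
    rcases c.eq_empty_or_nonempty with rfl | ⟨p₀, hp₀⟩
    · exact ⟨⟨μ, hpm, h1, fun _ => le_rfl⟩, fun _ h => h.elim⟩
    have hc' : IsChain (fun p q : RingSeminorm R => ∀ a, p a ≤ q a) (Subtype.val '' c) := by
      rintro _ ⟨p, hp, rfl⟩ _ ⟨q, hq, rfl⟩ hpq
      exact (hc hp hq (fun h => hpq (by rw [h]))).symm
    have hne : (Subtype.val '' c).Nonempty := ⟨_, p₀, hp₀, rfl⟩
    have := hne.to_subtype
    refine ⟨⟨chainInf _ hc' hne, fun a n hn => ?_, ?_,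
      fun a => (chainInf_le hc' hne ⟨p₀, hp₀, rfl⟩ a).trans (p₀.2.2.2 a)⟩,
      fun p hp a => chainInf_le hc' hne ⟨p, hp, rfl⟩ a⟩
    · refine le_antisymm (map_pow_le_pow _ _ (by omega)) ?_
      rw [chainInf_apply _ _ _ (a ^ n)]
      refine le_ciInf fun p => ?_
      obtain ⟨_, p, hp, rfl⟩ := p
      rw [p.2.1 a hn]
      exact pow_le_pow_left₀ (apply_nonneg _ _) (chainInf_le hc' hne ⟨p, hp, rfl⟩ a) n
    · rw [chainInf_apply]
      have : ∀ p : Subtype.val '' c, p.1 1 = 1 := by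
        rintro ⟨_, p, hp, rfl⟩
        exact p.2.2.1
      simp [this]
  obtain ⟨m, hm⟩ := exists_maximal_of_chains_bounded hchain
    (fun {p q s} hpq hqs a => (hqs a).trans (hpq a))
  exact ⟨m.1, m.2.1, m.2.2.1, m.2.2.2, fun q hq hq1 hqm a =>
    hm ⟨q, hq, hq1, fun a => (hqm a).trans (m.2.2.2 a)⟩ hqm a⟩

/-- A nonzero non-archimedean ring seminorm on a commutative ring dominates a multiplicative
seminorm. -/
theorem exists_mulRingSeminorm_le {R : Type*} [CommRing R] (μ : RingSeminorm R)
    (hna : IsNonarchimedean μ) (h1 : μ 1 ≠ 0) :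
    ∃ y : MulRingSeminorm R, ∀ a, y a ≤ μ a := by
  obtain ⟨q, hq, hq1, hqμ⟩ := exists_isPowMul_le μ hna h1
  obtain ⟨p, hp, hp1, hpq, hmin⟩ := exists_minimal_isPowMul q hq hq1
  refine ⟨{ p with map_one' := hp1, map_mul' := fun a b => ?_ }, fun a => (hpq a).trans (hqμ a)⟩
  change p (a * b) = p a * p b
  by_cases ha : p a = 0
  · have h := map_mul_le_mul p a b
    rw [ha, zero_mul] at h ⊢
    exact h.antisymm (apply_nonneg _ _)
  -- The limit of p(x aⁿ)/p(a)ⁿ is power-multiplicative and at most p, hence equals p by minimality;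
  -- multiplication by a is multiplicative for this limit.
  · have h : ∀ x, p x = seminormFromConst' a p x := fun x =>
      (hmin (seminormFromConst hp1.le ha hp) (seminormFromConst_isPowMul hp1.le ha hp)
        (seminormFromConst_one hp1.le ha hp)
        (seminormFromConst_le_seminorm hp1.le ha hp) x).antisymm
        (seminormFromConst_le_seminorm hp1.le ha hp x)
    rw [h (a * b), h a, h b]
    exact seminormFromConst_const_mul hp1.le ha hp b

/-- The distance to a principal ideal, as a seminorm on the ring. -/
def distToPrincipal {R : Type*} [CommRing R] (μ : RingSeminorm R) (b : R) : RingSeminorm R :=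
  have hb : ∀ a, BddBelow (Set.range fun v : R => μ (a - b * v)) := fun a =>
    ⟨0, by rintro _ ⟨v, rfl⟩; exact apply_nonneg μ _⟩
  { toFun := fun a => ⨅ v : R, μ (a - b * v)
    map_zero' := le_antisymm ((ciInf_le (hb 0) 0).trans (by simp))
      (le_ciInf fun _ => apply_nonneg μ _)
    neg' := fun a => by
      have key : ∀ a, (⨅ v : R, μ (-a - b * v)) ≤ ⨅ v : R, μ (a - b * v) := fun a => by
        refine le_ciInf fun v => (ciInf_le (hb (-a)) (-v)).trans (le_of_eq ?_)
        rw [← map_neg_eq_map μ]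
        congr 1
        ring
      exact (key a).antisymm (by simpa using key (-a))
    add_le' := fun a a' => le_ciInf_add_ciInf fun v w =>
      (ciInf_le (hb _) (v + w)).trans (by
        rw [show a + a' - b * (v + w) = (a - b * v) + (a' - b * w) by ring]
        exact map_add_le_add μ _ _)
    mul_le' := fun a a' => by
      refine le_mul_of_forall_lt₀ fun s hs t ht => ?_
      obtain ⟨v, hv⟩ := exists_lt_of_ciInf_lt hs
      obtain ⟨w, hw⟩ := exists_lt_of_ciInf_lt ht
      refine (ciInf_le (hb _) (a * w + v * a' - b * v * w)).trans ?_
      rw [show a * a' - b * (a * w + v * a' - b * v * w) = (a - b * v) * (a' - b * w) by ring]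
      exact (map_mul_le_mul μ _ _).trans (mul_le_mul hv.le hw.le (apply_nonneg _ _)
        ((apply_nonneg μ _).trans hv.le)) }

theorem distToPrincipal_le {R : Type*} [CommRing R] (μ : RingSeminorm R) (b a v : R) :
    distToPrincipal μ b a ≤ μ (a - b * v) :=
  ciInf_le (f := fun v : R => μ (a - b * v))
    ⟨0, by rintro _ ⟨v, rfl⟩; exact apply_nonneg μ _⟩ v

theorem isNonarchimedean_distToPrincipal {R : Type*} [CommRing R] {μ : RingSeminorm R}
    (hna : IsNonarchimedean μ) (b : R) : IsNonarchimedean (distToPrincipal μ b) := by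
  intro a a'
  refine le_of_forall_gt_imp_ge_of_dense fun r hr => ?_
  obtain ⟨v, hv⟩ := exists_lt_of_ciInf_lt ((le_max_left _ _).trans_lt hr)
  obtain ⟨w, hw⟩ := exists_lt_of_ciInf_lt ((le_max_right _ _).trans_lt hr)
  refine (distToPrincipal_le μ b _ (v + w)).trans ?_
  rw [show a + a' - b * (v + w) = (a - b * v) + (a' - b * w) by ring]
  exact (hna _ _).trans (max_le hv.le hw.le)

/-- If no multiple of `b` is at distance less than `1` from `1`, then some multiplicative seminorm
below the given one vanishes at `b`. -/
theorem exists_mulRingSeminorm_le_of_forall_one_le {R : Type*} [CommRing R] (μ : RingSeminorm R)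
    (hna : IsNonarchimedean μ) {b : R} (hb : ∀ v, 1 ≤ μ (1 - b * v)) :
    ∃ y : MulRingSeminorm R, (∀ a, y a ≤ μ a) ∧ y b = 0 := by
  have h1 : 1 ≤ distToPrincipal μ b 1 := le_ciInf hb
  obtain ⟨y, hy⟩ := exists_mulRingSeminorm_le (distToPrincipal μ b)
    (isNonarchimedean_distToPrincipal hna b) (zero_lt_one.trans_le h1).ne'
  refine ⟨y, fun a => (hy a).trans ((distToPrincipal_le μ b a 0).trans_eq (by simp)), ?_⟩
  refine ((hy b).trans ((distToPrincipal_le μ b b 1).trans_eq (by simp))).antisymm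
    (apply_nonneg _ _)

/-- A multiplicative seminorm that is bounded by a submultiplicative norm is below it. -/
theorem mulRingSeminorm_le_of_le_const_mul {R : Type*} [SeminormedRing R] (y : MulRingSeminorm R)
    {C : ℝ} (hC : ∀ a, y a ≤ C * ‖a‖) (a : R) : y a ≤ ‖a‖ := by
  have hC0 : 0 ≤ C := by
    by_contra! h
    have h1 := hC 1
    rw [map_one] at h1
    nlinarith [norm_nonneg (1 : R)]
  -- The 1 in the maximum covers n = 0, where ‖a⁰‖ = ‖1‖ need not be at most 1.
  refine le_of_pow_le_const_mul_pow (C := max C 1) (norm_nonneg a) fun n => ?_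
  rcases n.eq_zero_or_pos with rfl | hn
  · simp
  · rw [← map_pow]
    refine (hC _).trans ?_
    gcongr
    · exact le_max_left _ _
    · exact norm_pow_le' a hn

/-- A bounded multiplicative seminorm on a normed field is equal to the norm. -/
theorem mulRingSeminorm_eq_norm {K : Type*} [NormedField K] (y : MulRingSeminorm K)
    {C : ℝ} (hC : ∀ a, y a ≤ C * ‖a‖) (a : K) : y a = ‖a‖ := by
  have hle := mulRingSeminorm_le_of_le_const_mul y hC
  refine (hle a).antisymm ?_
  by_cases ha : a = 0
  · simp [ha]
  -- The upper bound at a⁻¹ is a lower bound at a.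
  · have h := hle a⁻¹
    have h1 : y a * y a⁻¹ = 1 := by rw [← map_mul, mul_inv_cancel₀ ha, map_one]
    rw [norm_inv] at h
    have hpos := norm_pos_iff.2 ha
    calc ‖a‖ = (y a * y a⁻¹) * ‖a‖ := by rw [h1, one_mul]
      _ ≤ (y a * ‖a‖⁻¹) * ‖a‖ := by
        gcongr
      _ = y a := by field_simp

/-- The pullback of a multiplicative seminorm along a ring homomorphism. -/
def pullback {R S : Type*} [Ring R] [Ring S] (y : MulRingSeminorm S) (φ : R →+* S) :
    MulRingSeminorm R where
  toFun a := y (φ a)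
  map_zero' := by simp
  add_le' a b := by
    rw [map_add]
    exact map_add_le_add y _ _
  neg' a := by simp
  map_one' := by simp
  map_mul' a b := by simp

theorem pullback_apply {R S : Type*} [Ring R] [Ring S] (y : MulRingSeminorm S) (φ : R →+* S)
    (a : R) : pullback y φ a = y (φ a) := rfl

/-! ### The Gelfand spectrum of a Banach algebra -/

/-- A point of the spectrum of the Banach algebra `E`: a multiplicative seminorm bounded by the
norm and extending the absolute value of `F`. -/
structure GelfandSpectrum (F E : Type*) [NormedField F] [NormedRing E] [NormedAlgebra F E] where
  /-- The seminorm attached to the point. -/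
  seminorm : MulRingSeminorm E
  le_norm : ∀ a, seminorm a ≤ ‖a‖
  map_algebraMap : ∀ c : F, seminorm (algebraMap F E c) = ‖c‖

namespace GelfandSpectrum

section

variable {F E : Type*} [NormedField F] [NormedRing E] [NormedAlgebra F E]

/-- A bounded multiplicative seminorm is a point of the spectrum. -/
def ofBounded (F : Type*) {E : Type*} [NormedField F] [NormedRing E] [NormedAlgebra F E]
    (y : MulRingSeminorm E) (hy : ∃ C, ∀ a, y a ≤ C * ‖a‖) :
    GelfandSpectrum F E where
  seminorm := y
  le_norm := mulRingSeminorm_le_of_le_const_mul y hy.choose_spec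
  -- On F the seminorm is bounded by ‖1‖ times the absolute value, and a field admits no smaller
  -- bounded multiplicative seminorm.
  map_algebraMap c := mulRingSeminorm_eq_norm (pullback y (algebraMap F E)) (C := ‖(1 : E)‖)
    (fun c => (mulRingSeminorm_le_of_le_const_mul y hy.choose_spec _).trans_eq (by
      rw [norm_algebraMap, mul_comm])) c

/-- The weakest topology making the evaluations continuous. -/
instance : TopologicalSpace (GelfandSpectrum F E) :=
  TopologicalSpace.induced (fun (y : GelfandSpectrum F E) (a : E) => y.seminorm a) inferInstance

theorem continuous_eval (a : E) : Continuous fun y : GelfandSpectrum F E => y.seminorm a :=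
  (continuous_apply a).comp continuous_induced_dom

theorem abs_sub_le (y : GelfandSpectrum F E) (a b : E) :
    |y.seminorm a - y.seminorm b| ≤ ‖a - b‖ :=
  (abs_sub_map_le_sub y.seminorm a b).trans (y.le_norm _)

/-- Points are 1-Lipschitz in the algebra element, uniformly in y, so continuity in y for fixed a
upgrades to joint continuity. -/
theorem continuous_eval_uncurry :
    Continuous fun p : E × GelfandSpectrum F E => p.2.seminorm p.1 := by
  refine continuous_iff_continuousAt.2 fun ⟨a, y⟩ => ?_
  have h1 : Filter.Tendsto (fun p : E × GelfandSpectrum F E =>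
      p.2.seminorm p.1 - p.2.seminorm a) (nhds (a, y)) (nhds 0) := by
    refine squeeze_zero_norm (fun p => p.2.abs_sub_le p.1 a) ?_
    have : Continuous fun p : E × GelfandSpectrum F E => ‖p.1 - a‖ := by fun_prop
    simpa using this.tendsto (a, y)
  have h2 : Filter.Tendsto (fun p : E × GelfandSpectrum F E => p.2.seminorm a)
      (nhds (a, y)) (nhds (y.seminorm a)) :=
    ((continuous_eval a).comp continuous_snd).tendsto (a, y)
  simpa [ContinuousAt] using h1.add h2

/-- All conditions are closed in the product topology, and the last confines the image to a product
of compact intervals; this yields compactness. -/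
theorem range_eval : Set.range (fun (y : GelfandSpectrum F E) (a : E) => y.seminorm a) =
    {φ : E → ℝ | φ 0 = 0 ∧ φ 1 = 1 ∧ (∀ a b, φ (a * b) = φ a * φ b) ∧
      (∀ a b, φ (a + b) ≤ φ a + φ b) ∧ (∀ a, φ (-a) = φ a) ∧
      (∀ c, φ (algebraMap F E c) = ‖c‖) ∧ ∀ a, φ a ∈ Set.Icc 0 ‖a‖} := by
  refine Set.Subset.antisymm ?_ ?_
  · rintro _ ⟨y, rfl⟩
    exact ⟨map_zero _, map_one _, map_mul _, map_add_le_add _, map_neg_eq_map _,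
      y.map_algebraMap, fun a => ⟨apply_nonneg _ _, y.le_norm a⟩⟩
  · rintro φ ⟨h0, h1, hm, ha, hn, hF, hb⟩
    exact ⟨⟨⟨⟨φ, h0, ha, hn⟩, h1, hm⟩, fun a => (hb a).2, hF⟩, rfl⟩

instance : CompactSpace (GelfandSpectrum F E) := by
  rw [← isCompact_univ_iff, Topology.IsInducing.isCompact_iff ⟨rfl⟩, Set.image_univ, range_eval]
  refine (isCompact_univ_pi fun a : E =>
    isCompact_Icc (a := (0 : ℝ)) (b := ‖a‖)).of_isClosed_subset ?_ fun φ h a _ => h.2.2.2.2.2.2 a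
  simp only [Set.ofPred_and, Set.ofPred_forall]
  refine .inter (isClosed_eq ?_ ?_) <| .inter (isClosed_eq ?_ ?_) <|
    .inter (isClosed_iInter fun a => isClosed_iInter fun b => isClosed_eq ?_ ?_) <|
    .inter (isClosed_iInter fun a => isClosed_iInter fun b => isClosed_le ?_ ?_) <|
    .inter (isClosed_iInter fun a => isClosed_eq ?_ ?_) <|
    .inter (isClosed_iInter fun c => isClosed_eq ?_ ?_) <|
    isClosed_iInter fun a => isClosed_Icc.preimage ?_
  all_goals fun_prop

end

section

variable {F E : Type*} [NormedField F] [NormedCommRing E] [NormedAlgebra F E]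

/-- The norm of E itself dominates a multiplicative seminorm. -/
instance [IsUltrametricDist E] [Nontrivial E] : Nonempty (GelfandSpectrum F E) := by
  obtain ⟨y, hy⟩ := exists_mulRingSeminorm_le (normRingSeminorm E)
    IsUltrametricDist.isNonarchimedean_norm (norm_ne_zero_iff.2 (one_ne_zero : (1 : E) ≠ 0))
  exact ⟨ofBounded F y ⟨1, fun a => (hy a).trans_eq (one_mul _).symm⟩⟩

/-- The point of the affine line at which the polynomial `P` has the value of `P(f)` at `y`. -/
def toAffineLine (f : E) (y : GelfandSpectrum F E) : AffineLine F where
  seminorm := pullback y.seminorm (Polynomial.aeval f : F[X] →ₐ[F] E).toRingHom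
  seminorm_C c := by
    rw [pullback_apply]
    simpa using y.map_algebraMap c

theorem continuous_toAffineLine_uncurry :
    Continuous (Function.uncurry (toAffineLine (F := F) (E := E))) := by
  refine continuous_induced_rng.2 (continuous_pi fun P => ?_)
  have h : Continuous fun f : E => Polynomial.aeval f P := Polynomial.continuous_aeval P
  exact continuous_eval_uncurry.comp ((h.comp continuous_fst).prodMk continuous_snd)

end

end GelfandSpectrum

/-! ### Points of the spectrum come from multiplicative seminorms -/

namespace UltraTensor

section

variable {F A B : Type*} [NormedField F] [NormedRing A] [NormedAlgebra F A] [NormedRing B]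
  [NormedAlgebra F B]

theorem isNonarchimedean_tensorSeminorm :
    IsNonarchimedean (tensorSeminorm (F := F) (A := A) (B := B)) := by
  intro z w
  change tensorNorm (z + w) ≤ max (tensorNorm z) (tensorNorm w)
  refine le_of_forall_gt_imp_ge_of_dense fun r hr => ?_
  obtain ⟨s, hs, hz⟩ := exists_hasRep_lt ((le_max_left _ _).trans_lt hr)
  obtain ⟨t, ht, hw⟩ := exists_hasRep_lt ((le_max_right _ _).trans_lt hr)
  exact (hz.add hw).tensorNorm_le.trans (max_le hs.le ht.le)

instance : Algebra F (UltraTensor F A B) := inferInstanceAs (Algebra F (A ⊗[F] B))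

/-- The homomorphism `a ↦ a ⊗ 1`. -/
def inclLeft : A →ₐ[F] UltraTensor F A B :=
  (Algebra.TensorProduct.includeLeft : A →ₐ[F] A ⊗[F] B)

/-- The homomorphism `b ↦ 1 ⊗ b`. -/
def inclRight : B →ₐ[F] UltraTensor F A B :=
  (Algebra.TensorProduct.includeRight : B →ₐ[F] A ⊗[F] B)

end

section

variable {F A B : Type*} [NormedField F] [NormedCommRing A] [NormedAlgebra F A] [NormedCommRing B]
  [NormedAlgebra F B]

instance : CommRing (UltraTensor F A B) where
  mul_comm := mul_comm (G := A ⊗[F] B)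

/-- An element that is invertible up to an error of norm less than `1` is invertible in the
completed tensor product. -/
theorem isUnit_coe_of_tensorNorm_lt {b v : UltraTensor F A B} (h : tensorNorm (1 - b * v) < 1) :
    IsUnit (b : CompletedTensor F A B) := by
  have hu : IsUnit ((b : CompletedTensor F A B) * (v : CompletedTensor F A B)) := by
    have h1 : ‖((1 - b * v : UltraTensor F A B) : CompletedTensor F A B)‖ < 1 := by
      rwa [UniformSpace.Completion.norm_coe]
    have h2 := isUnit_one_sub_of_norm_lt_one h1
    rwa [← UniformSpace.Completion.coe_one, ← UniformSpace.Completion.coe_sub, sub_sub_cancel,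
      UniformSpace.Completion.coe_mul] at h2
  -- A factor of the unit bv is a unit because the factors commute.
  have hc : Commute (b : CompletedTensor F A B) (v : CompletedTensor F A B) := by
    rw [commute_iff_eq, ← UniformSpace.Completion.coe_mul, ← UniformSpace.Completion.coe_mul,
      mul_comm]
  exact (hc.isUnit_mul_iff.1 hu).1

end

end UltraTensor

/-- Identifies the norm of P(T(x)) in ℋ(x) with |P(x)|. -/
theorem AffineLine.aeval_coord {F : Type*} [NormedField F] (x : AffineLine F) (P : F[X]) :
    Polynomial.aeval x.coord P = ((x.toResidueField P : x.ResidueField) :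
      x.CompletedResidueField) := by
  have h : ((Polynomial.aeval x.coord : F[X] →ₐ[F] x.CompletedResidueField) :
      F[X] →+* x.CompletedResidueField) =
      (UniformSpace.Completion.coeRingHom : x.ResidueField →+* _).comp x.toResidueField := by
    refine Polynomial.ringHom_ext (fun c => ?_) ?_
    · simp only [RingHom.coe_coe, Polynomial.aeval_C]
      rfl
    · simp only [RingHom.coe_coe, Polynomial.aeval_X]
      rfl
  exact congrArg (fun g : F[X] →+* x.CompletedResidueField => g P) h

theorem AffineLine.ext_seminorm {F : Type*} [NormedField F] {x x' : AffineLine F}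
    (h : ∀ P, x.seminorm P = x'.seminorm P) : x = x' := by
  cases x
  cases x'
  congr
  exact DFunLike.ext _ _ h

/-- A multiplicative seminorm z killing b cannot distinguish P(f) ⊗ 1 from 1 ⊗ P(T(x)). On the left
factor it is a point y, on the right it is the norm of ℋ(x), so |P(f)(y)| = |P(x)|. -/
theorem exists_toAffineLine_eq_of_mem {F E : Type*} [NormedField F] [NormedCommRing E]
    [NormedAlgebra F E] {f : E} {x : AffineLine F} (hx : x ∈ berkovichSpectrum F f) :
    ∃ y : GelfandSpectrum F E, y.toAffineLine f = x := by
  let b : UltraTensor F E x.CompletedResidueField :=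
    UltraTensor.inclLeft f - UltraTensor.inclRight x.coord
  have hb : ∀ v, 1 ≤ UltraTensor.tensorNorm (1 - b * v) := by
    intro v
    by_contra! h
    refine hx ?_
    have h1 := UltraTensor.isUnit_coe_of_tensorNorm_lt h
    rwa [UniformSpace.Completion.coe_sub] at h1
  obtain ⟨z, hz, hzb⟩ := exists_mulRingSeminorm_le_of_forall_one_le
    (R := UltraTensor F E x.CompletedResidueField) UltraTensor.tensorSeminorm
    UltraTensor.isNonarchimedean_tensorSeminorm hb
  let y := GelfandSpectrum.ofBounded F (pullback z
    (UltraTensor.inclLeft : E →ₐ[F] UltraTensor F E x.CompletedResidueField).toRingHom)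
    ⟨1, fun a => (hz _).trans
      ((UltraTensor.hasRep_tmul a (1 : x.CompletedResidueField)).tensorNorm_le.trans_eq
        (by rw [norm_one, mul_one, one_mul]))⟩
  -- On the field ℋ(x), z is multiplicative and bounded by ‖1‖ · ‖c‖, hence equal to the norm.
  have hr : ∀ c : x.CompletedResidueField, z (UltraTensor.inclRight c) = ‖c‖ := fun c =>
    mulRingSeminorm_eq_norm (pullback z
      (UltraTensor.inclRight : _ →ₐ[F] UltraTensor F E x.CompletedResidueField).toRingHom)
      (fun c => (hz _).trans (UltraTensor.hasRep_tmul (1 : E) c).tensorNorm_le) c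
  refine ⟨y, AffineLine.ext_seminorm fun P => ?_⟩
  -- u - v divides P(u) - P(v), with u = f ⊗ 1 and v = 1 ⊗ T(x).
  have hdvd : b ∣ UltraTensor.inclLeft (Polynomial.aeval f P) -
      UltraTensor.inclRight (Polynomial.aeval x.coord P) := by
    rw [← Polynomial.aeval_algHom_apply, ← Polynomial.aeval_algHom_apply,
      Polynomial.aeval_def, Polynomial.aeval_def, ← Polynomial.eval_map, ← Polynomial.eval_map]
    exact Polynomial.sub_dvd_eval_sub _ _ _
  obtain ⟨c, hc⟩ := hdvd
  have h0 : z (UltraTensor.inclLeft (Polynomial.aeval f P) -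
      UltraTensor.inclRight (Polynomial.aeval x.coord P)) = 0 := by
    rw [hc, map_mul, hzb, zero_mul]
  have h1 := abs_sub_map_le_sub z (UltraTensor.inclLeft (Polynomial.aeval f P))
    (UltraTensor.inclRight (Polynomial.aeval x.coord P))
  rw [h0, hr, x.aeval_coord, UniformSpace.Completion.norm_coe, x.norm_toResidueField] at h1
  exact sub_eq_zero.1 (abs_nonpos_iff.1 h1)

/-! ### Multiplicative seminorms give points of the spectrum -/

/-- A normed field is ultrametric once all natural numbers have norm at most 1, and their norms are
already determined in F. -/
theorem isUltrametricDist_completion {F K : Type*} [NormedField F] [IsUltrametricDist F]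
    [NormedField K] [NormedAlgebra F K] : IsUltrametricDist (UniformSpace.Completion K) := by
  refine IsUltrametricDist.isUltrametricDist_of_forall_norm_natCast_le_one fun n => ?_
  have h : ‖algebraMap F (UniformSpace.Completion K) (n : F)‖ ≤ 1 := by
    rw [norm_algebraMap']
    exact IsUltrametricDist.norm_natCast_le_one F n
  simpa using h

/-- Contracting homomorphisms from `A` and `B` into an ultrametric algebra induce a contraction
on the tensor product. -/
theorem norm_lift_le_tensorNorm {F A B C : Type*} [NormedField F] [NormedRing A]
    [NormedAlgebra F A] [NormedRing B] [NormedAlgebra F B] [NormedCommRing C] [NormedAlgebra F C]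
    [IsUltrametricDist C] (φ : A →ₐ[F] C) (ψ : B →ₐ[F] C) (hφ : ∀ a, ‖φ a‖ ≤ ‖a‖)
    (hψ : ∀ b, ‖ψ b‖ ≤ ‖b‖) (z : UltraTensor F A B) :
    ‖Algebra.TensorProduct.lift φ ψ (fun _ _ => Commute.all _ _) z‖ ≤
      UltraTensor.tensorNorm z := by
  refine le_csInf (UltraTensor.exists_hasRep z) ?_
  rintro r ⟨hr, l, rfl, hl⟩
  induction l with
  | nil =>
    exact (congrArg norm (map_zero (Algebra.TensorProduct.lift φ ψ
      (fun _ _ => Commute.all _ _)))).trans_le (norm_zero.trans_le hr)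
  | cons p l ih =>
    rw [List.map_cons, List.sum_cons]
    refine (congrArg norm (map_add (Algebra.TensorProduct.lift φ ψ
      (fun _ _ => Commute.all _ _)) _ _)).trans_le
      ((IsUltrametricDist.norm_add_le_max _ _).trans (max_le ?_ ?_))
    · refine le_trans ?_ (hl p List.mem_cons_self)
      refine (congrArg norm (Algebra.TensorProduct.lift_tmul φ ψ _ p.1 p.2)).trans_le ?_
      exact (norm_mul_le _ _).trans
        (mul_le_mul (hφ _) (hψ _) (norm_nonneg _) (norm_nonneg _))
    · exact ih fun q hq => hl q (List.mem_cons_of_mem _ hq)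

/-- The two contractions combine into a homomorphism on the completed tensor product that sends f ⊗
1 - 1 ⊗ T(x) to 0, which is no unit in a nontrivial ring. -/
theorem mem_berkovichSpectrum_of_algHom {F E C : Type*} [NormedField F] [NormedRing E]
    [NormedAlgebra F E] [NormedCommRing C] [NormedAlgebra F C] [IsUltrametricDist C]
    [CompleteSpace C] [Nontrivial C] {f : E} {x : AffineLine F}
    (φ : E →ₐ[F] C) (ψ : x.CompletedResidueField →ₐ[F] C) (hφ : ∀ a, ‖φ a‖ ≤ ‖a‖)
    (hψ : ∀ b, ‖ψ b‖ ≤ ‖b‖) (h : φ f = ψ x.coord) : x ∈ berkovichSpectrum F f := by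
  intro hu
  let Φ : UltraTensor F E x.CompletedResidueField →+* C :=
    (Algebra.TensorProduct.lift φ ψ (fun _ _ => Commute.all _ _)).toRingHom
  have hΦ : Continuous Φ :=
    AddMonoidHomClass.continuous_of_bound Φ 1 fun z => by
      rw [one_mul]
      exact norm_lift_le_tensorNorm φ ψ hφ hψ z
  have hΦt : ∀ a b, Φ (UltraTensor.tmul F a b) = φ a * ψ b := fun a b =>
    Algebra.TensorProduct.lift_tmul φ ψ _ a b
  have h1 := hu.map (UniformSpace.Completion.extensionHom Φ hΦ)
  rw [map_sub, CompletedTensor.tmul, CompletedTensor.tmul,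
    UniformSpace.Completion.extensionHom_coe, UniformSpace.Completion.extensionHom_coe, hΦt, hΦt,
    map_one, map_one, mul_one, one_mul, h, sub_self] at h1
  exact not_isUnit_zero h1

/-- An isometric homomorphism from the residue field of `x` to a complete algebra extends to the
completed residue field. -/
theorem AffineLine.exists_algHom_completedResidueField {F C : Type*} [NormedField F]
    [NormedCommRing C] [NormedAlgebra F C] [CompleteSpace C] (x : AffineLine F)
    (g : x.ResidueField →+* C) (hg : ∀ a, ‖g a‖ = ‖a‖)
    (hF : ∀ c : F, g (x.toResidueField (Polynomial.C c)) = algebraMap F C c) :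
    ∃ ψ : x.CompletedResidueField →ₐ[F] C, (∀ b, ‖ψ b‖ ≤ ‖b‖) ∧
      ∀ a : x.ResidueField, ψ a = g a := by
  have hc : Continuous g := (AddMonoidHomClass.isometry_of_norm g hg).continuous
  refine ⟨{ UniformSpace.Completion.extensionHom g hc with
    commutes' := fun c => ?_ }, fun b => ?_, fun a =>
      UniformSpace.Completion.extensionHom_coe g hc a⟩
  · exact (UniformSpace.Completion.extensionHom_coe g hc _).trans (hF c)
  · change ‖UniformSpace.Completion.extensionHom g hc b‖ ≤ ‖b‖
    induction b using UniformSpace.Completion.induction_on with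
    | hp =>
      exact isClosed_le (UniformSpace.Completion.continuous_extension.norm) continuous_norm
    | ih a =>
      rw [UniformSpace.Completion.extensionHom_coe, UniformSpace.Completion.norm_coe, hg]

/-- A homomorphism from `F[T]` to a normed field inducing the seminorm of `x` extends to the
residue field of `x`. -/
theorem AffineLine.exists_ringHom_residueField {F K : Type*} [NormedField F] [NormedField K]
    (x : AffineLine F) (g : F[X] →+* K) (hg : ∀ P, ‖g P‖ = x.seminorm P) :
    ∃ h : x.ResidueField →+* K, (∀ a, ‖h a‖ = ‖a‖) ∧ ∀ P, h (x.toResidueField P) = g P := by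
  let q : F[X] ⧸ x.ker →+* K := Ideal.Quotient.lift x.ker g fun P hP => by
    rw [← norm_eq_zero, hg]
    exact hP
  have hq : ∀ P, q (Ideal.Quotient.mk x.ker P) = g P := fun P => Ideal.Quotient.lift_mk _ _ _
  have hinj : Function.Injective q := by
    refine (injective_iff_map_eq_zero q).2 fun a ha => ?_
    obtain ⟨P, rfl⟩ := Ideal.Quotient.mk_surjective a
    rw [hq, ← norm_eq_zero, hg] at ha
    exact Ideal.Quotient.eq_zero_iff_mem.2 ha
  let h : x.ResidueField →+* K :=
    IsFractionRing.lift (K := FractionRing (F[X] ⧸ x.ker)) hinj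
  have hh : ∀ P, h (x.toResidueField P) = g P := fun P =>
    (IsFractionRing.lift_algebraMap (K := FractionRing (F[X] ⧸ x.ker)) hinj _).trans (hq P)
  refine ⟨h, fun a => ?_, hh⟩
  obtain ⟨r, s, -, hrs⟩ := IsFractionRing.div_surjective (A := F[X] ⧸ x.ker)
    (K := FractionRing (F[X] ⧸ x.ker)) a
  obtain ⟨P, rfl⟩ := Ideal.Quotient.mk_surjective r
  obtain ⟨Q, rfl⟩ := Ideal.Quotient.mk_surjective s
  have ha : a = x.toResidueField P / x.toResidueField Q := hrs.symm
  rw [ha, map_div₀, norm_div, norm_div, hh, hh, hg, hg, x.norm_toResidueField,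
    x.norm_toResidueField]

/-- Every multiplicative seminorm on a commutative ring comes from a homomorphism to a normed
field. -/
theorem exists_ringHom_normedField.{u} {R : Type u} [CommRing R] (y : MulRingSeminorm R) :
    ∃ (K : Type u) (_ : NormedField K) (g : R →+* K), ∀ a, ‖g a‖ = y a := by
  let I : Ideal R :=
    { carrier := {a | y a = 0}
      zero_mem' := map_zero y
      add_mem' := fun {a b} (ha : y a = 0) (hb : y b = 0) =>
        ((map_add_le_add y a b).trans_eq (by rw [ha, hb, add_zero])).antisymm (apply_nonneg _ _)
      smul_mem' := fun a b (hb : y b = 0) => by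
        change y (a * b) = 0
        rw [map_mul, hb, mul_zero] }
  have hI : ∀ a, a ∈ I ↔ y a = 0 := fun a => Iff.rfl
  have : I.IsPrime :=
    { ne_top' := by
        rw [Ne, Ideal.eq_top_iff_one, hI, map_one]
        exact one_ne_zero
      mem_or_mem' := fun {a b} h => by
        rwa [hI, map_mul, mul_eq_zero] at h }
  let v : AbsoluteValue (R ⧸ I) ℝ :=
    { toFun := Quotient.lift (fun a : R => y a) fun a b h => by
        have h0 : y (a - b) = 0 := (Submodule.quotientRel_def _).1 h
        have h1 := abs_sub_map_le_sub y a b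
        rw [h0] at h1
        exact sub_eq_zero.1 (abs_nonpos_iff.1 h1)
      map_mul' := by
        intro a b
        obtain ⟨a, rfl⟩ := Ideal.Quotient.mk_surjective a
        obtain ⟨b, rfl⟩ := Ideal.Quotient.mk_surjective b
        exact map_mul y a b
      nonneg' := by
        intro a
        obtain ⟨a, rfl⟩ := Ideal.Quotient.mk_surjective a
        exact apply_nonneg y a
      eq_zero' := by
        intro a
        obtain ⟨a, rfl⟩ := Ideal.Quotient.mk_surjective a
        exact Iff.symm Ideal.Quotient.eq_zero_iff_mem
      add_le' := by
        intro a b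
        obtain ⟨a, rfl⟩ := Ideal.Quotient.mk_surjective a
        obtain ⟨b, rfl⟩ := Ideal.Quotient.mk_surjective b
        exact map_add_le_add y a b }
  exact ⟨FractionRing (R ⧸ I), (fractionAbs v).toNormedField,
    (algebraMap (R ⧸ I) (FractionRing (R ⧸ I))).comp (Ideal.Quotient.mk I),
    fun a => fractionAbs_algebraMap v (Ideal.Quotient.mk I a)⟩

/-- The target is the completion of a valued field K realizing y. It receives E, and also ℋ(x)
because evaluation at the image of f induces on F[T] the seminorm of x. -/
theorem GelfandSpectrum.toAffineLine_mem_berkovichSpectrum {F E : Type*} [NormedField F]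
    [IsUltrametricDist F] [NormedCommRing E] [NormedAlgebra F E] (f : E)
    (y : GelfandSpectrum F E) : y.toAffineLine f ∈ berkovichSpectrum F f := by
  obtain ⟨K, _, g, hg⟩ := exists_ringHom_normedField y.seminorm
  let _ : NormedAlgebra F K :=
    { (g.comp (algebraMap F E)).toAlgebra with
      norm_smul_le := fun c a => by
        change ‖g (algebraMap F E c) * a‖ ≤ ‖c‖ * ‖a‖
        rw [norm_mul, hg, y.map_algebraMap] }
  have := isUltrametricDist_completion (F := F) (K := K)
  obtain ⟨h, hh, hP⟩ := (y.toAffineLine f).exists_ringHom_residueField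
    (g.comp (Polynomial.aeval f : F[X] →ₐ[F] E).toRingHom) fun P => hg _
  let ι : K →+* UniformSpace.Completion K := UniformSpace.Completion.coeRingHom
  have hι : ∀ a, ‖ι a‖ = ‖a‖ := UniformSpace.Completion.norm_coe
  obtain ⟨ψ, hψ, hψh⟩ := (y.toAffineLine f).exists_algHom_completedResidueField (ι.comp h)
    (fun a => (hι _).trans (hh a)) fun c => by
      rw [RingHom.comp_apply, hP]
      change ι (g (Polynomial.aeval f (Polynomial.C c))) = ι (g (algebraMap F E c))
      rw [Polynomial.aeval_C]
  refine mem_berkovichSpectrum_of_algHom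
    { ι.comp g with commutes' := fun c => rfl } ψ
    (fun a => ((hι _).trans (hg a)).trans_le (y.le_norm a)) hψ ?_
  rw [AffineLine.coord, hψh, RingHom.comp_apply, hP]
  change ι (g f) = ι (g (Polynomial.aeval f Polynomial.X))
  rw [Polynomial.aeval_X]

theorem berkovichSpectrum_eq_range {F E : Type*} [NormedField F] [IsUltrametricDist F]
    [NormedCommRing E] [NormedAlgebra F E] (f : E) :
    berkovichSpectrum F f = Set.range (GelfandSpectrum.toAffineLine (F := F) f) :=
  Set.Subset.antisymm (fun _ hx => exists_toAffineLine_eq_of_mem hx)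
    (Set.range_subset_iff.2 fun y => y.toAffineLine_mem_berkovichSpectrum f)

end

end BerkovichSpectrum

/-- The spectrum of every element of a non-zero commutative ultrametric Banach algebra `E` over a
complete non-archimedean field `F` is a nonempty compact subset of the Berkovich affine line, and
the resulting map from `E` to the space of nonempty compact subsets, with the exponential (Vietoris)
topology, is continuous. -/
theorem mainTheorem5 {F : Type*} [NormedField F] [IsUltrametricDist F] [CompleteSpace F]
    {E : Type*} [NormedCommRing E] [NormedAlgebra F E] [IsUltrametricDist E] [CompleteSpace E]
    [Nontrivial E] :
    ∃ S : E → TopologicalSpace.NonemptyCompacts (BerkovichSpectrum.AffineLine F),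
      (∀ f : E, (S f : Set (BerkovichSpectrum.AffineLine F)) =
        BerkovichSpectrum.berkovichSpectrum F f) ∧
      Continuous S := by
  have hc := BerkovichSpectrum.GelfandSpectrum.continuous_toAffineLine_uncurry (F := F) (E := E)
  -- The family maps the constant compact set M(E), so joint continuity alone gives Vietoris
  -- continuity.
  refine ⟨fun f => (⊤ : TopologicalSpace.NonemptyCompacts
    (BerkovichSpectrum.GelfandSpectrum F E)).map _ (hc.comp (Continuous.prodMk_right f)),
    fun f => ?_, Continuous.nonemptyCompacts_map' continuous_const hc⟩
  rw [BerkovichSpectrum.berkovichSpectrum_eq_range, TopologicalSpace.NonemptyCompacts.coe_map,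
    TopologicalSpace.NonemptyCompacts.coe_top, Set.image_univ]
  rfl
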